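/- Fix a nonempty set $\Lambda$ of labels. A weak transition system consists of a set $S$ of states, a set $L$ of actions, a labelling map $\mu:L\to\Lambda$ and, for every $n\geq 1$, a set of $n$-transitions $(\alpha,u_1,\dots,u_n,\beta)\in S\times L^n\times S$, such that (multiset axiom) transitions are stable under permutation of $u_1,\dots,u_n$, and (composition axiom) for $n\geq 3$ and $p,q\geq 1$ with $p+q<n$, if $(\alpha,u_1,\dots,u_n,\beta)$, $(\alpha,u_1,\dots,u_p,\nu_1)$, $(\nu_1,u_{p+1},\dots,u_n,\beta)$, $(\alpha,u_1,\dots,u_{p+q},\nu_2)$ and $(\nu_2,u_{p+q+1},\dots,u_n,\beta)$ are transitions, then so is $(\nu_1,u_{p+1},\dots,u_{p+q},\nu_2)$. Maps are pairs of maps on states and on actions preserving labels and transitions. The system is cubical if every action $u$ occurs in a $1$-transition $(\alpha,u,\beta)$ and if for every transition $(\alpha,u_1,\dots,u_n,\beta)$ with $n\geq 2$ and every $1\leq p<n$ there is a state $\nu$ such that $(\alpha,u_1,\dots,u_p,\nu)$ and $(\nu,u_{p+1},\dots,u_n,\beta)$ are transitions; it is regular if moreover such a $\nu$ is always unique. It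 satisfies CSA1 if $u=u'$ whenever $(\alpha,u,\beta)$ and $(\alpha,u',\beta)$ are transitions with $\mu(u)=\mu(u')$. Let $\mathcal{CTS}$ and $\mathcal{RTS}$ be the categories of cubical and of regular transition systems, let $\mathrm{CSA}_2:\mathcal{CTS}\to\mathcal{RTS}$ be the reflection (left adjoint of the inclusion), and let $\mathrm{CSA}_1^{\mathcal{CTS}}:\mathcal{CTS}\to\mathcal{CTS}$ and $\mathrm{CSA}_1^{\mathcal{RTS}}:\mathcal{RTS}\to\mathcal{RTS}$ be the reflections onto the full subcategories of objects satisfying CSA1. For $X$ regular, the unit $X\to\mathrm{CSA}_1^{\mathcal{RTS}}(X)$ factors uniquely through the composite of units $X\to\mathrm{CSA}_1^{\mathcal{CTS}}(X)\to\mathrm{CSA}_2(\mathrm{CSA}_1^{\mathcal{CTS}}(X))$; the resulting map $\mathrm{CSA}_2(\mathrm{CSA}_1^{\mathcal{CTS}}(X))\to\mathrm{CSA}_1^{\mathcal{RTS}}(X)$ is called the comparison map. **Proposition.** There is a regular transition system $X$ for which the comparison map $\mathrm{CSA}_2(\mathrm{CSA}_1^{\mathcal{CTS}}(X))\to\mathrm{CSA}_1^{\mathcal{RTS}}(X)$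 is not an isomorphism. More precisely, for every $x\in\Lambda$ let $X$ be the regular transition system with the eleven states $\alpha,\beta,\gamma,\chi,\chi',\nu,\nu',U_1,V_1,U_2,V_2$, the six actions $u_1,u_2,u_1',u_2',v,v'$, all labelled by $x$, and the transitions $$(\alpha,u_1,u_2,\beta),(\alpha,u_2,u_1,\beta),(\alpha,u_1,\chi),(\chi,u_2,\beta),(\alpha,u_2,\nu),(\nu,u_1,\beta),$$ $$(\alpha,u'_1,u'_2,\beta),(\alpha,u'_2,u'_1,\beta),(\alpha,u'_1,\chi'),(\chi',u'_2,\beta),(\alpha,u'_2,\nu'),(\nu',u'_1,\beta),$$ $$(\gamma,v,\chi),(\gamma,v',\chi'),(U_1,u_1,V_1),(U_1,u'_1,V_1),(U_2,u_2,V_2),(U_2,u'_2,V_2).$$ Then the comparison map of $X$ is not an isomorphism. The images of the actions $v$ and $v'$ are distinct in $\mathrm{CSA}_1^{\mathcal{CTS}}(X)$ and in $\mathrm{CSA}_2(\mathrm{CSA}_1^{\mathcal{CTS}}(X))$, and the comparison map sends the latter two images to the same action of $\mathrm{CSA}_1^{\mathcal{RTS}}(X)$. -/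

import Mathlib

open CategoryTheory

universe u

/-- A weak higher dimensional transition system over the set of labels `Λ`: a set of states, a set
of actions, a labelling map, and for each `n ≥ 1` a set of `n`-transitions
`(α, u₁, …, uₙ, β)`; the tuple `(u₁, …, uₙ)` is written as a list, which is nonempty for a
transition. It satisfies the multiset axiom and the composition axiom. -/
structure WTS (Λ : Type u) : Type (u + 1) where
  /-- the states -/
  State : Type u
  /-- the actions -/
  Act : Type u
  /-- the labelling map -/
  μ : Act → Λ
  /-- `tr α [u₁, …, uₙ] β` means that `(α, u₁, …, uₙ, β)` is a transition -/
  tr : State → List Act → State → Prop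
  tr_ne_nil : ∀ {α l β}, tr α l β → l ≠ []
  /-- Multiset axiom -/
  multiset : ∀ {α l l' β}, l.Perm l' → tr α l β → tr α l' β
  /-- Composition axiom -/
  composition : ∀ {α β ν₁ ν₂ : State} {a b c : List Act}, a ≠ [] → b ≠ [] → c ≠ [] →
    tr α (a ++ b ++ c) β → tr α a ν₁ → tr ν₁ (b ++ c) β → tr α (a ++ b) ν₂ → tr ν₂ c β →
    tr ν₁ b ν₂

namespace WTS

variable {Λ : Type u}

/-- Maps of weak transition systems. -/
@[ext]
structure Hom (X Y : WTS Λ) : Type u where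
  /-- the map on states -/
  onState : X.State → Y.State
  /-- the map on actions -/
  onAct : X.Act → Y.Act
  μ_onAct : ∀ u, Y.μ (onAct u) = X.μ u
  map_tr : ∀ {α l β}, X.tr α l β → Y.tr (onState α) (l.map onAct) (onState β)

/-- The category of weak transition systems over `Λ`. -/
instance category : Category (WTS Λ) where
  Hom := Hom
  id X := ⟨id, id, fun _ => rfl, fun h => by simpa using h⟩
  comp f g := ⟨g.onState ∘ f.onState, g.onAct ∘ f.onAct,
    fun u => (g.μ_onAct _).trans (f.μ_onAct u), fun h => by simpa using g.map_tr (f.map_tr h)⟩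

@[ext]
theorem hom_ext {X Y : WTS Λ} {f g : X ⟶ Y} (h₀ : f.onState = g.onState)
    (h₁ : f.onAct = g.onAct) : f = g :=
  Hom.ext h₀ h₁

@[simp]
theorem comp_onState {X Y Z : WTS Λ} (f : X ⟶ Y) (g : Y ⟶ Z) (s : X.State) :
    (f ≫ g).onState s = g.onState (f.onState s) := rfl

@[simp]
theorem comp_onAct {X Y Z : WTS Λ} (f : X ⟶ Y) (g : Y ⟶ Z) (s : X.Act) :
    (f ≫ g).onAct s = g.onAct (f.onAct s) := rfl

@[simp]
theorem id_onState {X : WTS Λ} (s : X.State) : (𝟙 X : X ⟶ X).onState s = s := rfl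

@[simp]
theorem id_onAct {X : WTS Λ} (s : X.Act) : (𝟙 X : X ⟶ X).onAct s = s := rfl

/-- All actions are used. -/
def AllActionsUsed (X : WTS Λ) : Prop :=
  ∀ u : X.Act, ∃ α β, X.tr α [u] β

/-- Intermediate state axiom. -/
def IntermediateState (X : WTS Λ) : Prop :=
  ∀ {α β : X.State} {a b : List X.Act}, a ≠ [] → b ≠ [] → X.tr α (a ++ b) β →
    ∃ ν, X.tr α a ν ∧ X.tr ν b β

/-- Unique intermediate state axiom, also called CSA2. -/
def IsCSA2 : ObjectProperty (WTS Λ) := fun X =>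
  ∀ {α β : X.State} {a b : List X.Act}, a ≠ [] → b ≠ [] → X.tr α (a ++ b) β →
    ∃! ν, X.tr α a ν ∧ X.tr ν b β

/-- First Cattani-Sassone axiom, CSA1. -/
def IsCSA1 : ObjectProperty (WTS Λ) := fun X =>
  ∀ {α β : X.State} {u u' : X.Act}, X.tr α [u] β → X.tr α [u'] β → X.μ u = X.μ u' → u = u'

/-- Cubical transition systems. -/
def IsCubical : ObjectProperty (WTS Λ) := fun X =>
  X.AllActionsUsed ∧ X.IntermediateState

/-- Regular transition systems. -/
def IsRegular : ObjectProperty (WTS Λ) := fun X =>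
  X.AllActionsUsed ∧ X.IsCSA2

theorem isRegular_le_isCubical : (IsRegular : ObjectProperty (WTS Λ)) ≤ IsCubical :=
  fun _ h => ⟨h.1, fun ha hb ht => (h.2 ha hb ht).exists⟩

/-- Cubical transition systems satisfying CSA1. -/
def IsCubicalCSA1 : ObjectProperty (WTS Λ) := fun X => X.IsCubical ∧ X.IsCSA1

/-- Regular transition systems satisfying CSA1. -/
def IsRegularCSA1 : ObjectProperty (WTS Λ) := fun X => X.IsRegular ∧ X.IsCSA1

theorem isCubicalCSA1_le : (IsCubicalCSA1 : ObjectProperty (WTS Λ)) ≤ IsCubical :=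
  fun _ h => h.1

theorem isRegularCSA1_le : (IsRegularCSA1 : ObjectProperty (WTS Λ)) ≤ IsRegular :=
  fun _ h => h.1

/-! ### The largest quotient of a cubical transition system that embeds into systems satisfying `A`

The reflections below are all computed by dividing out states and actions by the relation
"identified by every map to a system satisfying `A`", and by giving the quotient the smallest set
of transitions that makes the projection a map. -/

section Quotient

variable (A : ObjectProperty (WTS Λ)) (X : WTS Λ)

/-- Two states are related when every map from `X` to a system satisfying `A` identifies them. -/
def stateSetoid : Setoid X.State where
  r s s' := ∀ (Y : WTS Λ), A Y → ∀ f : X ⟶ Y, f.onState s = f.onState s'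
  iseqv := ⟨fun _ _ _ _ => rfl, fun h Y hY f => (h Y hY f).symm,
    fun h h' Y hY f => (h Y hY f).trans (h' Y hY f)⟩

/-- Two actions are related when they have the same label and every map from `X` to a system
satisfying `A` identifies them. -/
def actSetoid : Setoid X.Act where
  r u u' := X.μ u = X.μ u' ∧ ∀ (Y : WTS Λ), A Y → ∀ f : X ⟶ Y, f.onAct u = f.onAct u'
  iseqv := ⟨fun _ => ⟨rfl, fun _ _ _ => rfl⟩,
    fun h => ⟨h.1.symm, fun Y hY f => (h.2 Y hY f).symm⟩,
    fun h h' => ⟨h.1.trans h'.1, fun Y hY f => (h.2 Y hY f).trans (h'.2 Y hY f)⟩⟩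

/-- The smallest set of transitions on the quotient that contains the images of the transitions
of `X` and satisfies the multiset and composition axioms. -/
inductive QuotTr :
    Quotient (stateSetoid A X) → List (Quotient (actSetoid A X)) →
      Quotient (stateSetoid A X) → Prop
  | of {α l β} : X.tr α l β →
      QuotTr (Quotient.mk _ α) (l.map (Quotient.mk _)) (Quotient.mk _ β)
  | perm {α l l' β} : l.Perm l' → QuotTr α l β → QuotTr α l' β
  | comp {α β ν₁ ν₂ a b c} : a ≠ [] → b ≠ [] → c ≠ [] →
      QuotTr α (a ++ b ++ c) β → QuotTr α a ν₁ → QuotTr ν₁ (b ++ c) β →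
      QuotTr α (a ++ b) ν₂ → QuotTr ν₂ c β → QuotTr ν₁ b ν₂

/-- The quotient system. -/
def quot : WTS Λ where
  State := Quotient (stateSetoid A X)
  Act := Quotient (actSetoid A X)
  μ := Quotient.lift X.μ fun _ _ h => h.1
  tr := QuotTr A X
  tr_ne_nil h := by
    induction h with
    | of h => simpa using X.tr_ne_nil h
    | perm hp _ ih => exact fun h => ih (by subst h; exact hp.eq_nil)
    | comp _ hb => exact hb
  multiset := QuotTr.perm
  composition := QuotTr.comp

/-- The projection to the quotient. -/
def quotMk : X ⟶ quot A X where
  onState := Quotient.mk _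
  onAct := Quotient.mk _
  μ_onAct _ := rfl
  map_tr := QuotTr.of

variable {A X}

theorem QuotTr.lift {Y : WTS Λ} (p : Quotient (stateSetoid A X) → Y.State)
    (q : Quotient (actSetoid A X) → Y.Act)
    (hpq : ∀ {α l β}, X.tr α l β →
      Y.tr (p (Quotient.mk _ α)) (l.map fun u => q (Quotient.mk _ u)) (p (Quotient.mk _ β)))
    {α l β} (h : QuotTr A X α l β) : Y.tr (p α) (l.map q) (p β) := by
  induction h with
  | of h =>
    rw [List.map_map]
    exact hpq h
  | perm hp _ ih => exact Y.multiset (hp.map _) ih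
  | comp ha hb hc _ _ _ _ _ h₁ h₂ h₃ h₄ h₅ =>
    rw [List.map_append] at h₃ h₄
    rw [List.map_append, List.map_append] at h₁
    exact Y.composition (mt List.map_eq_nil_iff.1 ha) (mt List.map_eq_nil_iff.1 hb)
      (mt List.map_eq_nil_iff.1 hc) h₁ h₂ h₃ h₄ h₅

/-- Every map to a system satisfying `A` factors through the quotient. -/
def quotLift {Y : WTS Λ} (hY : A Y) (f : X ⟶ Y) : quot A X ⟶ Y where
  onState := Quotient.lift f.onState fun _ _ h => h Y hY f
  onAct := Quotient.lift f.onAct fun _ _ h => h.2 Y hY f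
  μ_onAct := by
    rintro ⟨u⟩
    exact f.μ_onAct u
  map_tr h := QuotTr.lift _ _ (fun h => f.map_tr h) h

theorem quotMk_quotLift {Y : WTS Λ} (hY : A Y) (f : X ⟶ Y) : quotMk A X ≫ quotLift hY f = f := rfl

theorem quot_hom_ext {Y : WTS Λ} {f g : quot A X ⟶ Y} (h : quotMk A X ≫ f = quotMk A X ≫ g) :
    f = g := by
  apply hom_ext
  · funext s
    induction s using Quotient.inductionOn with
    | h s => exact congrFun (congrArg Hom.onState h) s
  · funext s
    induction s using Quotient.inductionOn with
    | h s => exact congrFun (congrArg Hom.onAct h) s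

theorem quot_state_eq {s s' : (quot A X).State}
    (h : ∀ (Y : WTS Λ), A Y → ∀ f : quot A X ⟶ Y, f.onState s = f.onState s') : s = s' := by
  induction s using Quotient.inductionOn with
  | h s =>
    induction s' using Quotient.inductionOn with
    | h s' => exact Quotient.sound fun Y hY f => h Y hY (quotLift hY f)

theorem quot_act_eq {s s' : (quot A X).Act} (hμ : (quot A X).μ s = (quot A X).μ s')
    (h : ∀ (Y : WTS Λ), A Y → ∀ f : quot A X ⟶ Y, f.onAct s = f.onAct s') : s = s' := by
  induction s using Quotient.inductionOn with
  | h s =>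
    induction s' using Quotient.inductionOn with
    | h s' => exact Quotient.sound ⟨hμ, fun Y hY f => h Y hY (quotLift hY f)⟩

theorem exists_perm_of_map_perm {B C : Type u} (f : B → C) {l : List B} {l' : List C}
    (h : (l.map f).Perm l') : ∃ l₀, l.Perm l₀ ∧ l₀.map f = l' := by
  generalize hm : l.map f = m at h
  induction h generalizing l with
  | nil => exact ⟨l, .refl _, hm⟩
  | cons x _ ih =>
    obtain ⟨y, l₁, rfl, rfl, h₁⟩ := List.map_eq_cons_iff.1 hm
    obtain ⟨l₀, hp, rfl⟩ := ih h₁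
    exact ⟨y :: l₀, hp.cons y, rfl⟩
  | swap x y t =>
    obtain ⟨y, l₁, rfl, rfl, h₁⟩ := List.map_eq_cons_iff.1 hm
    obtain ⟨z, l₂, rfl, rfl, rfl⟩ := List.map_eq_cons_iff.1 h₁
    exact ⟨z :: y :: l₂, .swap _ _ _, rfl⟩
  | trans _ _ ih₁ ih₂ =>
    obtain ⟨l₁, hp₁, h₁⟩ := ih₁ hm
    obtain ⟨l₂, hp₂, h₂⟩ := ih₂ h₁
    exact ⟨l₂, hp₁.trans hp₂, h₂⟩

/-- The quotient of a cubical transition system is cubical. -/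
theorem quot_isCubical (hX : X.IsCubical) : (quot A X).IsCubical := by
  refine ⟨fun u => ?_, ?_⟩
  · induction u using Quotient.inductionOn with
    | h u =>
      obtain ⟨α, β, h⟩ := hX.1 u
      exact ⟨_, _, QuotTr.of h⟩
  · have key : ∀ {α l β}, QuotTr A X α l β → ∀ a b, a ≠ [] → b ≠ [] → l.Perm (a ++ b) →
        ∃ ν, QuotTr A X α a ν ∧ QuotTr A X ν b β := by
      intro α l β h
      induction h with
      | of h =>
        intro a b ha hb hp
        obtain ⟨l₀, hp₀, h₀⟩ := exists_perm_of_map_perm _ hp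
        obtain ⟨a₀, b₀, rfl, rfl, rfl⟩ := List.map_eq_append_iff.1 h₀
        obtain ⟨ν, h₁, h₂⟩ := hX.2 (by simpa using ha) (by simpa using hb) (X.multiset hp₀ h)
        exact ⟨_, .of h₁, .of h₂⟩
      | perm hp _ ih =>
        intro a b ha hb hp'
        exact ih a b ha hb (hp.trans hp')
      | @comp α β ν₁ ν₂ a' b' c' ha' hb' hc' h₁ h₂ h₃ h₄ h₅ _ _ ih _ _ =>
        intro a b ha hb hp
        have hp' : (b' ++ c').Perm (a ++ (b ++ c')) := by
          simpa using hp.append_right c'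
        obtain ⟨ν₃, k₁, k₂⟩ := ih a (b ++ c') ha (by simp [hb]) hp'
        refine ⟨ν₃, k₁, ?_⟩
        exact .comp ha hb hc' (.perm (by simpa using hp') h₃) k₁ k₂
          (.perm hp (.comp ha' hb' hc' h₁ h₂ h₃ h₄ h₅)) h₅
    intro α β a b ha hb h
    exact key h a b ha hb (.refl _)

theorem quot_isRegular (hA : A ≤ IsCSA2) (hX : X.IsCubical) : (quot A X).IsRegular := by
  have hc := quot_isCubical (A := A) hX
  refine ⟨hc.1, fun {α β a b} ha hb h => ?_⟩
  obtain ⟨ν, h₁, h₂⟩ := hc.2 ha hb h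
  refine ⟨ν, ⟨h₁, h₂⟩, ?_⟩
  rintro ν' ⟨h₁', h₂'⟩
  refine quot_state_eq fun Y hY f => ?_
  have h' := f.map_tr h
  rw [List.map_append] at h'
  exact (hA Y hY (by simpa using ha) (by simpa using hb) h').unique
    ⟨f.map_tr h₁', f.map_tr h₂'⟩ ⟨f.map_tr h₁, f.map_tr h₂⟩

theorem quot_isCSA1 (hA : A ≤ IsCSA1) : (quot A X).IsCSA1 := by
  intro α β u u' h h' hμ
  refine quot_act_eq hμ fun Y hY f => ?_
  exact hA Y hY (f.map_tr h) (f.map_tr h') (by rw [f.μ_onAct, f.μ_onAct, hμ])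

end Quotient

/-- The hom-set bijection exhibiting `quot A` as a reflection from the systems satisfying `Q` to
those satisfying `P`. -/
def quotEquiv {A P Q : ObjectProperty (WTS Λ)} (hPA : P ≤ A) (hPQ : P ≤ Q)
    (h : ∀ X, Q X → P (quot A X)) (X : Q.FullSubcategory) (Y : P.FullSubcategory) :
    ((⟨quot A X.obj, h _ X.property⟩ : P.FullSubcategory) ⟶ Y) ≃
      (X ⟶ (ObjectProperty.ιOfLE hPQ).obj Y) where
  toFun f := ObjectProperty.homMk (quotMk A X.obj ≫ f.hom)
  invFun f := ObjectProperty.homMk (quotLift (hPA _ Y.property) f.hom)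
  left_inv f := by
    ext1
    exact quot_hom_ext rfl
  right_inv f := rfl

/-- The reflection from the systems satisfying `Q` to those satisfying `P`. -/
@[reducible]
def quotReflective {A P Q : ObjectProperty (WTS Λ)} (hPA : P ≤ A) (hPQ : P ≤ Q)
    (h : ∀ X, Q X → P (quot A X)) : Reflective (ObjectProperty.ιOfLE hPQ) where
  L := Adjunction.leftAdjointOfEquiv (quotEquiv hPA hPQ h) (fun _ _ _ _ _ => rfl)
  adj := Adjunction.adjunctionOfEquivLeft (quotEquiv hPA hPQ h) (fun _ _ _ _ _ => rfl)

end WTS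

open WTS

/-- The category of cubical transition systems, a full subcategory of `WTS Λ`. -/
abbrev CTS (Λ : Type u) := (IsCubical : ObjectProperty (WTS Λ)).FullSubcategory

/-- The category of regular transition systems, a full subcategory of `WTS Λ`. -/
abbrev RTS (Λ : Type u) := (IsRegular : ObjectProperty (WTS Λ)).FullSubcategory

/-- The category of cubical transition systems satisfying CSA1. -/
abbrev CTSCSA1 (Λ : Type u) := (IsCubicalCSA1 : ObjectProperty (WTS Λ)).FullSubcategory

/-- The category of regular transition systems satisfying CSA1. -/
abbrev RTSCSA1 (Λ : Type u) := (IsRegularCSA1 : ObjectProperty (WTS Λ)).FullSubcategory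

namespace RTS

variable {Λ : Type u}

/-- The inclusion of regular transition systems into cubical ones. -/
abbrev toCTS : RTS Λ ⥤ CTS Λ := ObjectProperty.ιOfLE isRegular_le_isCubical

end RTS

section Reflections

variable {Λ : Type u}

/-- The inclusion of cubical transition systems satisfying CSA1 into cubical ones. -/
abbrev CTSCSA1.toCTS : CTSCSA1 Λ ⥤ CTS Λ := ObjectProperty.ιOfLE isCubicalCSA1_le

/-- The inclusion of regular transition systems satisfying CSA1 into regular ones. -/
abbrev RTSCSA1.toRTS : RTSCSA1 Λ ⥤ RTS Λ := ObjectProperty.ιOfLE isRegularCSA1_le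

instance : Reflective (RTS.toCTS (Λ := Λ)) :=
  quotReflective (A := IsCSA2) (fun _ h => h.2) _ fun _ hX => quot_isRegular le_rfl hX

instance : Reflective (CTSCSA1.toCTS (Λ := Λ)) :=
  quotReflective (A := IsCSA1) (fun _ h => h.2) _
    fun _ hX => ⟨quot_isCubical hX, quot_isCSA1 le_rfl⟩

instance : Reflective (RTSCSA1.toRTS (Λ := Λ)) :=
  quotReflective (A := IsCSA1 ⊓ IsCSA2) (fun _ h => ⟨h.2, h.1.2⟩) _
    fun _ hX => ⟨quot_isRegular inf_le_right (isRegular_le_isCubical _ hX),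
      quot_isCSA1 inf_le_left⟩

/-- The functor `CSA₂`, the reflection of cubical transition systems into regular ones. -/
abbrev CSA₂ : CTS Λ ⥤ RTS Λ := reflector RTS.toCTS

/-- The functor `CSA₁^CTS`, the reflection of cubical transition systems into the cubical
transition systems satisfying CSA1. -/
abbrev CSA₁CTS : CTS Λ ⥤ CTS Λ := reflector CTSCSA1.toCTS ⋙ CTSCSA1.toCTS

/-- The functor `CSA₁^RTS`, the reflection of regular transition systems into the regular
transition systems satisfying CSA1. -/
abbrev CSA₁RTS : RTS Λ ⥤ RTS Λ := reflector RTSCSA1.toRTS ⋙ RTSCSA1.toRTS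

/-- The unit `X ⟶ CSA₂ X`. -/
abbrev CSA₂.unit (X : CTS Λ) : X ⟶ RTS.toCTS.obj (CSA₂.obj X) :=
  (reflectorAdjunction RTS.toCTS).unit.app X

/-- The unit `X ⟶ CSA₁^CTS X`. -/
abbrev CSA₁CTS.unit (X : CTS Λ) : X ⟶ CSA₁CTS.obj X :=
  (reflectorAdjunction CTSCSA1.toCTS).unit.app X

/-- The unit `X ⟶ CSA₁^RTS X`. -/
abbrev CSA₁RTS.unit (X : RTS Λ) : X ⟶ CSA₁RTS.obj X :=
  (reflectorAdjunction RTSCSA1.toRTS).unit.app X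

/-- `CSA₂` is also the reflection of cubical transition systems into the weak transition systems
satisfying CSA2. -/
theorem CSA₂.existsUnique_factor (X : CTS Λ) (Y : WTS Λ) (hY : Y.IsCSA2) (f : X.obj ⟶ Y) :
    ∃! g : (CSA₂.obj X).obj ⟶ Y, (CSA₂.unit X).hom ≫ g = f :=
  ⟨quotLift hY f, rfl, fun _ hg => quot_hom_ext hg⟩

/-- The canonical map `X ⟶ CSA₂ (CSA₁^CTS X)` for `X` regular. -/
def unitComposite (X : RTS Λ) :
    RTS.toCTS.obj X ⟶ RTS.toCTS.obj (CSA₂.obj (CSA₁CTS.obj (RTS.toCTS.obj X))) :=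
  CSA₁CTS.unit (RTS.toCTS.obj X) ≫ CSA₂.unit (CSA₁CTS.obj (RTS.toCTS.obj X))

/-- The map `X ⟶ CSA₁^RTS X` factors uniquely through `X ⟶ CSA₂ (CSA₁^CTS X)`. -/
theorem existsUnique_comparison (X : RTS Λ) :
    ∃! k : CSA₂.obj (CSA₁CTS.obj (RTS.toCTS.obj X)) ⟶ CSA₁RTS.obj X,
      unitComposite X ≫ RTS.toCTS.map k = RTS.toCTS.map (CSA₁RTS.unit X) := by
  let Z : CTSCSA1 Λ := ⟨(CSA₁RTS.obj X).obj, isRegular_le_isCubical _ (CSA₁RTS.obj X).property,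
    ((reflector RTSCSA1.toRTS).obj X).property.2⟩
  let e₁ := (reflectorAdjunction CTSCSA1.toCTS).homEquiv (RTS.toCTS.obj X) Z
  let e₂ := (reflectorAdjunction RTS.toCTS).homEquiv (CSA₁CTS.obj (RTS.toCTS.obj X))
    (CSA₁RTS.obj X)
  have h : ∀ k, unitComposite X ≫ RTS.toCTS.map k = e₁ (ObjectProperty.homMk (e₂ k).hom) := by
    intro k
    simp only [e₁, e₂, Adjunction.homEquiv_unit, unitComposite, Category.assoc]
    rfl
  refine ⟨e₂.symm (ObjectProperty.homMk (e₁.symm (RTS.toCTS.map (CSA₁RTS.unit X))).hom), ?_, ?_⟩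
  · dsimp only
    rw [h, Equiv.apply_symm_apply]
    exact e₁.apply_symm_apply _
  · intro k hk
    rw [h] at hk
    rw [Equiv.eq_symm_apply, ← hk, Equiv.symm_apply_apply]
    rfl

/-- The comparison map `CSA₂ (CSA₁^CTS X) ⟶ CSA₁^RTS X`: the unique map through which the unit
`X ⟶ CSA₁^RTS X` factors. -/
noncomputable def comparison (X : RTS Λ) :
    CSA₂.obj (CSA₁CTS.obj (RTS.toCTS.obj X)) ⟶ CSA₁RTS.obj X :=
  (existsUnique_comparison X).exists.choose

theorem unitComposite_comparison (X : RTS Λ) :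
    unitComposite X ≫ RTS.toCTS.map (comparison X) = RTS.toCTS.map (CSA₁RTS.unit X) :=
  (existsUnique_comparison X).exists.choose_spec

end Reflections

/-! ### The example -/

namespace Example

/-- The states. -/
inductive St : Type u
  | α | β | γ | χ | χ' | ν | ν' | U₁ | V₁ | U₂ | V₂

/-- The actions. -/
inductive Ac : Type u
  | u₁ | u₂ | u₁' | u₂' | v | v'

open St Ac

/-- The transitions. -/
inductive Tr : St.{u} → List Ac.{u} → St.{u} → Prop
  | a₁ : Tr α [u₁, u₂] β
  | a₂ : Tr α [u₂, u₁] β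
  | a₃ : Tr α [u₁] χ
  | a₄ : Tr χ [u₂] β
  | a₅ : Tr α [u₂] ν
  | a₆ : Tr ν [u₁] β
  | b₁ : Tr α [u₁', u₂'] β
  | b₂ : Tr α [u₂', u₁'] β
  | b₃ : Tr α [u₁'] χ'
  | b₄ : Tr χ' [u₂'] β
  | b₅ : Tr α [u₂'] ν'
  | b₆ : Tr ν' [u₁'] β
  | c₁ : Tr γ [v] χ
  | c₂ : Tr γ [v'] χ'
  | d₁ : Tr U₁ [u₁] V₁
  | d₂ : Tr U₁ [u₁'] V₁
  | d₃ : Tr U₂ [u₂] V₂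
  | d₄ : Tr U₂ [u₂'] V₂

theorem Tr.length_le {s t : St.{u}} {l : List Ac.{u}} (h : Tr s l t) : l.length ≤ 2 := by
  cases h <;> simp

variable {Λ : Type u}

/-- The underlying weak transition system: all actions are labelled by `x`. -/
def weak (x : Λ) : WTS Λ where
  State := St
  Act := Ac
  μ _ := x
  tr := Tr
  tr_ne_nil h := by cases h <;> simp
  multiset hp h := by
    cases h <;> first
      | (rw [List.singleton_perm] at hp; subst hp; constructor)
      | (rcases List.perm_pair.1 hp.symm with rfl | rfl <;> constructor)
  composition {_ _ _ _ a b c} ha hb hc h := by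
    have h' := h.length_le
    have := List.length_pos_iff.2 ha
    have := List.length_pos_iff.2 hb
    have := List.length_pos_iff.2 hc
    simp only [List.length_append] at h'
    omega

theorem Tr.existsUnique {s t : St.{u}} {a b : List Ac.{u}} (ha : a ≠ []) (hb : b ≠ [])
    (h : Tr s (a ++ b) t) : ∃! r, Tr s a r ∧ Tr r b t := by
  have h' := h.length_le
  obtain ⟨y, a, rfl⟩ := List.exists_cons_of_ne_nil ha
  obtain ⟨z, b, rfl⟩ := List.exists_cons_of_ne_nil hb
  simp only [List.length_append, List.length_cons] at h'
  obtain rfl : a = [] := List.length_eq_zero_iff.1 (by omega)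
  obtain rfl : b = [] := List.length_eq_zero_iff.1 (by omega)
  change Tr s [y, z] t at h
  cases h
  · exact ⟨_, ⟨Tr.a₃, Tr.a₄⟩, fun r hr => by obtain ⟨⟨⟩, ⟨⟩⟩ := hr; rfl⟩
  · exact ⟨_, ⟨Tr.a₅, Tr.a₆⟩, fun r hr => by obtain ⟨⟨⟩, ⟨⟩⟩ := hr; rfl⟩
  · exact ⟨_, ⟨Tr.b₃, Tr.b₄⟩, fun r hr => by obtain ⟨⟨⟩, ⟨⟩⟩ := hr; rfl⟩
  · exact ⟨_, ⟨Tr.b₅, Tr.b₆⟩, fun r hr => by obtain ⟨⟨⟩, ⟨⟩⟩ := hr; rfl⟩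

theorem weak_isRegular (x : Λ) : (weak x).IsRegular := by
  refine ⟨?_, fun ha hb h => Tr.existsUnique ha hb h⟩
  rintro (_ | _ | _ | _ | _ | _)
  exacts [⟨_, _, Tr.a₃⟩, ⟨_, _, Tr.a₅⟩, ⟨_, _, Tr.b₃⟩, ⟨_, _, Tr.b₅⟩, ⟨_, _, Tr.c₁⟩,
    ⟨_, _, Tr.c₂⟩]

/-- The example, as a regular transition system. -/
def system (x : Λ) : RTS Λ := ⟨weak x, weak_isRegular x⟩

/-- The action `v` of the example. -/
def v (x : Λ) : (system x).obj.Act := Ac.v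

/-- The action `v'` of the example. -/
def v' (x : Λ) : (system x).obj.Act := Ac.v'

end Example

/-!
In a system satisfying both CSA1 and CSA2, every map out of the example identifies `v` and `v'`:
CSA1 gives `u₁ = u₁'` and `u₂ = u₂'`, then CSA2 gives `χ = χ'`, and a second use of CSA1 gives
`v = v'` (`Example.onAct_v_eq_of_isCSA1_of_isCSA2`). Doing CSA1 first and CSA2 afterwards misses the
last step, for two reasons.

* CSA1 alone does not identify `χ` and `χ'`, so it does not identify `v` and `v'`. The system
  `Example.separating x` satisfies CSA1 and receives a map from the example that separates `v` from
  `v'` (`Example.onAct_csa₁CTS_unit_ne`).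
* The reflection `CSA₂` never identifies distinct actions, because every system maps, identically on
  actions, to a system with a single state, which satisfies CSA2 for trivial reasons
  (`CSA₂.onAct_unit_injective`).

Thus the comparison map is not injective on actions, hence not an isomorphism.
-/

namespace WTS

variable {Λ : Type u}

/-- The system with a single state and the same labelled actions as `X`, in which every nonempty
list of actions is a transition. -/
def oneState (X : WTS Λ) : WTS Λ where
  State := PUnit
  Act := X.Act
  μ := X.μ
  tr _ l _ := l ≠ []
  tr_ne_nil h := h
  multiset hp h := fun h' => h (by subst h'; exact hp.eq_nil)
  composition _ hb _ _ _ _ _ _ := hb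

theorem oneState_isCSA2 (X : WTS Λ) : X.oneState.IsCSA2 :=
  fun ha hb _ => ⟨PUnit.unit, ⟨ha, hb⟩, fun _ _ => rfl⟩

/-- The map to the one-state system that is the identity on actions. -/
def toOneState (X : WTS Λ) : X ⟶ X.oneState where
  onState _ := PUnit.unit
  onAct := id
  μ_onAct _ := rfl
  map_tr h := by simpa [oneState] using X.tr_ne_nil h

theorem onAct_injective_of_isIso {X Y : WTS Λ} (f : X ⟶ Y) [IsIso f] :
    Function.Injective f.onAct := fun a b h => by
  have key : ∀ c, (inv f).onAct (f.onAct c) = c := fun c => by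
    rw [← comp_onAct, IsIso.hom_inv_id, id_onAct]
  rw [← key a, h, key]

end WTS

theorem CSA₂.onAct_unit_injective {Λ : Type u} (X : CTS Λ) :
    Function.Injective (CSA₂.unit X).hom.onAct := fun a b h => by
  obtain ⟨g, hg, -⟩ :=
    CSA₂.existsUnique_factor X X.obj.oneState X.obj.oneState_isCSA2 X.obj.toOneState
  have h' := congrArg g.onAct h
  rwa [← comp_onAct, ← comp_onAct, hg] at h'

namespace Example

variable {Λ : Type u}

/-- A weak transition system satisfying CSA1 on the states of the example. The actions are
propositions, all labelled by `x`. For any two states `s` and `t` there is exactly one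
`1`-transition from `s` to `t`, whose action is the truth value of `s = γ ∧ t = χ'`; every pair of
actions is a `2`-transition between any two states, and there are no longer transitions. -/
def separating (x : Λ) : WTS Λ where
  State := St.{u}
  Act := ULift.{u} Prop
  μ _ := x
  tr s l t := l = [⟨s = St.γ ∧ t = St.χ'⟩] ∨ l.length = 2
  tr_ne_nil h := by rintro rfl; simp at h
  multiset hp h := by
    rcases h with rfl | h
    · exact Or.inl (List.singleton_perm.1 hp).symm
    · exact Or.inr (hp.length_eq ▸ h)
  composition {_ _ _ _ a b c} ha hb hc h := by
    have h' : (a ++ b ++ c).length ≤ 2 := by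
      rcases h with h | h
      · simp [h]
      · exact h.le
    have := List.length_pos_iff.2 ha
    have := List.length_pos_iff.2 hb
    have := List.length_pos_iff.2 hc
    simp only [List.length_append] at h'
    omega

theorem separating_isCSA1 (x : Λ) : (separating x).IsCSA1 := by
  have key : ∀ {s t : St.{u}} {a : ULift.{u} Prop}, (separating x).tr s [a] t →
      a = ⟨s = St.γ ∧ t = St.χ'⟩ := by
    rintro s t a (ha | ha)
    · exact List.singleton_injective ha
    · exact absurd (show 1 = 2 from ha) (by decide)
  intro s t a b ha hb _
  exact (key ha).trans (key hb).symm

/-- The map from the example to `separating x` sending the action `v'` to the true proposition and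
every other action to the false one. -/
def toSeparating (x : Λ) : weak x ⟶ separating x where
  onState := id
  onAct a := ⟨a = Ac.v'⟩
  μ_onAct _ := rfl
  map_tr := by
    have key : ∀ {s t : St.{u}} {l : List Ac.{u}}, Tr s l t →
        l.map (fun a => (⟨a = Ac.v'⟩ : ULift.{u} Prop)) = [⟨s = St.γ ∧ t = St.χ'⟩] ∨
          (l.map fun a => (⟨a = Ac.v'⟩ : ULift.{u} Prop)).length = 2 := by
      rintro s t l (_ | _) <;> simp
    exact fun {_ _ _} h => key h

theorem onAct_csa₁CTS_unit_ne (x : Λ) :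
    (CSA₁CTS.unit (RTS.toCTS.obj (system x))).hom.onAct (v x) ≠
      (CSA₁CTS.unit (RTS.toCTS.obj (system x))).hom.onAct (v' x) := fun h => by
  -- The unit is the projection to the quotient, so `h` is about two elements of a quotient.
  have h₁ := (Quotient.exact h).2 _ (separating_isCSA1 x) (toSeparating x)
  have h₂ : (Ac.v.{u} = Ac.v') = (Ac.v'.{u} = Ac.v') := congrArg ULift.down h₁
  simp at h₂

theorem onAct_v_eq_of_isCSA1_of_isCSA2 {x : Λ} {Y : WTS Λ} (h₁ : Y.IsCSA1) (h₂ : Y.IsCSA2)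
    (f : weak x ⟶ Y) : f.onAct Ac.v = f.onAct Ac.v' := by
  have hμ : ∀ a b : Ac, Y.μ (f.onAct a) = Y.μ (f.onAct b) := fun a b =>
    (f.μ_onAct a).trans (f.μ_onAct b).symm
  have hu₁ : f.onAct Ac.u₁ = f.onAct Ac.u₁' := h₁ (f.map_tr Tr.d₁) (f.map_tr Tr.d₂) (hμ _ _)
  have hu₂ : f.onAct Ac.u₂ = f.onAct Ac.u₂' := h₁ (f.map_tr Tr.d₃) (f.map_tr Tr.d₄) (hμ _ _)
  -- Both `χ` and `χ'` become the intermediate state of the image of `(α, u₁, u₂, β)`.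
  have hχ : f.onState St.χ = f.onState St.χ' := by
    refine (h₂ (a := [f.onAct Ac.u₁]) (b := [f.onAct Ac.u₂]) (by simp) (by simp)
      (f.map_tr Tr.a₁)).unique ⟨f.map_tr Tr.a₃, f.map_tr Tr.a₄⟩ ?_
    rw [hu₁, hu₂]
    exact ⟨f.map_tr Tr.b₃, f.map_tr Tr.b₄⟩
  have hv : Y.tr (f.onState St.γ) [f.onAct Ac.v] (f.onState St.χ) := f.map_tr Tr.c₁
  rw [hχ] at hv
  exact h₁ hv (f.map_tr Tr.c₂) (hμ _ _)

theorem onAct_unitComposite_ne (x : Λ) :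
    (unitComposite (system x)).hom.onAct (v x) ≠
      (unitComposite (system x)).hom.onAct (v' x) :=
  fun h => onAct_csa₁CTS_unit_ne x (CSA₂.onAct_unit_injective _ h)

theorem onAct_comparison_eq (x : Λ) :
    (comparison (system x)).hom.onAct ((unitComposite (system x)).hom.onAct (v x)) =
      (comparison (system x)).hom.onAct ((unitComposite (system x)).hom.onAct (v' x)) := by
  have h : ∀ a, (comparison (system x)).hom.onAct ((unitComposite (system x)).hom.onAct a) =
      (CSA₁RTS.unit (system x)).hom.onAct a := fun a =>
    congrArg (fun f : RTS.toCTS.obj (system x) ⟶ RTS.toCTS.obj (CSA₁RTS.obj (system x)) =>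
      f.hom.onAct a) (unitComposite_comparison (system x))
  rw [h, h]
  exact onAct_v_eq_of_isCSA1_of_isCSA2 ((reflector RTSCSA1.toRTS).obj (system x)).property.2
    (CSA₁RTS.obj (system x)).property.2 (CSA₁RTS.unit (system x)).hom

theorem not_isIso_comparison (x : Λ) : ¬ IsIso (comparison (system x)) := fun _ => by
  have : IsIso (comparison (system x)).hom :=
    inferInstanceAs (IsIso ((ObjectProperty.ι IsRegular).map (comparison (system x))))
  exact onAct_unitComposite_ne x (onAct_injective_of_isIso _ (onAct_comparison_eq x))

end Example

theorem mainTheorem12 (Λ : Type u) [Nonempty Λ] :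
    (∃ X : RTS Λ, ¬ IsIso (comparison X)) ∧
    ∀ x : Λ,
      ¬ IsIso (comparison (Example.system x)) ∧
      (CSA₁CTS.unit (RTS.toCTS.obj (Example.system x))).hom.onAct (Example.v x) ≠
        (CSA₁CTS.unit (RTS.toCTS.obj (Example.system x))).hom.onAct (Example.v' x) ∧
      (unitComposite (Example.system x)).hom.onAct (Example.v x) ≠
        (unitComposite (Example.system x)).hom.onAct (Example.v' x) ∧
      (comparison (Example.system x)).hom.onAct
          ((unitComposite (Example.system x)).hom.onAct (Example.v x)) =
        (comparison (Example.system x)).hom.onAct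
          ((unitComposite (Example.system x)).hom.onAct (Example.v' x)) :=
  ⟨⟨Example.system (Classical.arbitrary Λ), Example.not_isIso_comparison _⟩, fun x =>
    ⟨Example.not_isIso_comparison x, Example.onAct_csa₁CTS_unit_ne x,
      Example.onAct_unitComposite_ne x, Example.onAct_comparison_eq x⟩⟩
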